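/- Let $\mathbb T$ be the unit circle; all integrals over $\mathbb T$, $\mathbb T^2=\mathbb T\times\mathbb T$ and $\mathbb T^{\mathbb N}$ are with respect to normalized Haar measure. For a complex Banach space $X$: - $H_2(X)$ is the space of all $f\in L_2(\mathbb T,X)$ with $\int_{\mathbb T} f(w)w^{-n}\,dw=0$ for all $n<0$, with the $L_2$ norm. - $H_2(\mathbb T^{\mathbb N},X)$ is the space of all $f\in L_2(\mathbb T^{\mathbb N},X)$ whose Fourier coefficients $\hat f(\alpha)=\int f(w)w^{-\alpha}\,dw$, where $\alpha$ is a finitely supported sequence of integers, vanish whenever $\alpha$ has a negative entry. - For $n\ge 1$ with prime factorization $n=\prod_k p_k^{\alpha_k}$, $p_1<p_2<\cdots$ being the primes, put $\alpha(n)=(\alpha_1,\alpha_2,\dots)$. $\mathcal H_2(X)$ is the space of all formal Dirichlet series $\sum_n x_n n^{-s}$ for which there is an $f\in H_2(\mathbb T^{\mathbb N},X)$ with $\hat f(\alpha(n))=x_n$ for all $n\ge1$; the norm of the series is that of the (unique) $f$. A sequence $(e_n)_{n\ge1}$ in a complex normed space is called RUC if there is a constant $C$ such that for all $m$ and all $a_1,\dots,a_m\in\mathbb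 C$ $$\mathbb E\Big\|\sum_{n=1}^m\varepsilon_n a_n e_n\Big\|:=\frac1{2^m}\sum_{\varepsilon\in\{-1,1\}^m}\Big\|\sum_{n=1}^m \varepsilon_n a_n e_n\Big\|\le C\,\Big\|\sum_{n=1}^m a_n e_n\Big\| .$$ **Example.** Let $X=L_1(\mathbb T^2)$ and define $(x_n)_{n\ge1}\subseteq X$ by $x_n(w_1,w_2)=w_1^k$ if $n=2^k$ for some integer $k\ge0$, and $x_n(w_1,w_2)=w_2^{2^n}$ otherwise. Then 1. $(x_n z^n)_{n\ge1}$ is RUC in $H_2(X)$; 2. $(x_n n^{-s})_{n\ge1}$ is not RUC in $\mathcal H_2(X)$; 3. the $L_2(\mathbb T)$ norm of trigonometric polynomials is not dominated by their $L_1(\mathbb T)$ norm: there is no constant $C$ such that $\big\|\sum_{n=1}^N a_n w^n\big\|_{L_2(\mathbb T)}\le C\,\big\|\sum_{n=1}^N a_n w^n\big\|_{L_1(\mathbb T)}$ for all $N$ and all $a_1,\dots,a_N\in\mathbb C$. -/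

import Mathlib

open MeasureTheory
open scoped ENNReal NNReal

/-- The Borel σ-algebra of the unit circle. -/
noncomputable instance circleMeasurableSpace : MeasurableSpace Circle := borel Circle

instance circleBorelSpace : BorelSpace Circle := ⟨rfl⟩

noncomputable section

/-! ### Haar measure, and integration of vector functions against continuous scalar functions -/

/-- The normalized Haar measure of a compact group. -/
def haarProb (G : Type*) [Group G] [TopologicalSpace G] [IsTopologicalGroup G] [CompactSpace G]
    [MeasurableSpace G] [BorelSpace G] : Measure G :=
  Measure.haarMeasure ⊤

instance haarProb_isHaarMeasure (G : Type*) [Group G] [TopologicalSpace G] [IsTopologicalGroup G]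
    [CompactSpace G] [MeasurableSpace G] [BorelSpace G] : (haarProb G).IsHaarMeasure :=
  inferInstanceAs (Measure.haarMeasure ⊤).IsHaarMeasure

instance haarProb_isProbabilityMeasure (G : Type*) [Group G] [TopologicalSpace G]
    [IsTopologicalGroup G] [CompactSpace G] [MeasurableSpace G] [BorelSpace G] :
    IsProbabilityMeasure (haarProb G) :=
  ⟨Measure.haarMeasure_self⟩

section Pairing

variable {G : Type*} [Group G] [TopologicalSpace G] [IsTopologicalGroup G] [CompactSpace G]
  [MeasurableSpace G] [BorelSpace G]
theorem integrable_Lp {X : Type*} [NormedAddCommGroup X] {p : ℝ≥0∞} [Fact (1 ≤ p)]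
    (f : Lp X p (haarProb G)) : Integrable f (haarProb G) :=
  (Lp.memLp f).integrable Fact.out

variable {X : Type*} [NormedAddCommGroup X] [NormedSpace ℂ X]

theorem integrable_continuous_smul (φ : C(G, ℂ)) {f : G → X} (hf : Integrable f (haarProb G)) :
    Integrable (fun w => φ w • f w) (haarProb G) :=
  hf.bdd_smul ‖φ‖ φ.continuous.aestronglyMeasurable
    (Filter.Eventually.of_forall fun w => φ.norm_coe_le_norm w)

/-- `f ↦ ∫ φ(w) f(w) dw`, for a continuous function `φ`, on `L_p(G, X)`. -/
def pairing (p : ℝ≥0∞) [Fact (1 ≤ p)] (φ : C(G, ℂ)) : Lp X p (haarProb G) →ₗ[ℂ] X where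
  toFun f := ∫ w, φ w • f w ∂(haarProb G)
  map_add' f g := by
    rw [← integral_add (integrable_continuous_smul φ (integrable_Lp f))
      (integrable_continuous_smul φ (integrable_Lp g))]
    refine integral_congr_ae ?_
    filter_upwards [Lp.coeFn_add f g] with w hw
    rw [hw, Pi.add_apply, smul_add]
  map_smul' c f := by
    rw [RingHom.id_apply, ← integral_smul]
    refine integral_congr_ae ?_
    filter_upwards [Lp.coeFn_smul c f] with w hw
    rw [hw, Pi.smul_apply, smul_comm]

/-- A function whose integral against every continuous function is zero vanishes. -/
theorem ae_eq_zero_of_integral_continuous_smul [TopologicalSpace.PseudoMetrizableSpace G]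
    [CompleteSpace X] {f : G → X} (hf : Integrable f (haarProb G))
    (h : ∀ φ : C(G, ℂ), ∫ w, φ w • f w ∂(haarProb G) = 0) : f =ᵐ[haarProb G] 0 := by
  refine ae_eq_zero_of_forall_setIntegral_isClosed_eq_zero hf fun s hs => ?_
  have hlim : Filter.Tendsto
      (fun n => ∫ w, (((hs.apprSeq n w : ℝ≥0) : ℝ) : ℂ) • f w ∂(haarProb G)) Filter.atTop
      (nhds (∫ w, s.indicator f w ∂(haarProb G))) := by
    refine tendsto_integral_of_dominated_convergence (fun w => ‖f w‖) ?_ hf.norm ?_ ?_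
    · intro n
      refine AEStronglyMeasurable.smul ?_ hf.1
      have : Continuous fun w => (((hs.apprSeq n w : ℝ≥0) : ℝ) : ℂ) := by fun_prop
      exact this.aestronglyMeasurable
    · intro n
      refine Filter.Eventually.of_forall fun w => ?_
      rw [norm_smul]
      refine mul_le_of_le_one_left (norm_nonneg _) ?_
      have := HasOuterApproxClosed.apprSeq_apply_le_one hs n w
      simpa using this
    · refine Filter.Eventually.of_forall fun w => ?_
      have h1 := (tendsto_pi_nhds.1 (HasOuterApproxClosed.tendsto_apprSeq hs)) w
      have h2 : Filter.Tendsto (fun n => (((hs.apprSeq n w : ℝ≥0) : ℝ) : ℂ)) Filter.atTop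
          (nhds (((s.indicator (fun _ => (1 : ℝ≥0)) w : ℝ≥0) : ℝ) : ℂ)) :=
        ((Complex.continuous_ofReal.comp NNReal.continuous_coe).tendsto _).comp h1
      have h3 := h2.smul_const (f w)
      by_cases hw : w ∈ s <;> simpa [hw] using h3
  rw [integral_indicator hs.measurableSet] at hlim
  refine tendsto_nhds_unique hlim ?_
  have : ∀ n, ∫ w, (((hs.apprSeq n w : ℝ≥0) : ℝ) : ℂ) • f w ∂(haarProb G) = 0 := fun n =>
    h ⟨fun w => (((hs.apprSeq n w : ℝ≥0) : ℝ) : ℂ), by fun_prop⟩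
  simp only [this]
  exact tendsto_const_nhds

/-- The integral of a nontrivial continuous character is zero. -/
theorem integral_character_eq_zero (χ : G →* Circle) (hne : ∃ z, χ z ≠ 1) :
    ∫ w, (χ w : ℂ) ∂(haarProb G) = 0 := by
  obtain ⟨z, hz⟩ := hne
  have h := integral_mul_left_eq_self (μ := haarProb G) (fun w => (χ w : ℂ)) z
  simp only [map_mul, Circle.coe_mul, integral_const_mul] at h
  have h1 : ((χ z : ℂ) - 1) * ∫ w, (χ w : ℂ) ∂(haarProb G) = 0 := by
    rw [sub_mul, h, one_mul, sub_self]
  rcases mul_eq_zero.1 h1 with h2 | h2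
  · exact absurd (Circle.ext (by simpa [sub_eq_zero] using h2)) hz
  · exact h2

end Pairing

/-! ### Power series: the Hardy space `H_p(X)` on the circle -/

/-- The monomial `z ↦ z ^ n` on the circle, `n ∈ ℤ`. -/
def circleMonomial (n : ℤ) : C(Circle, ℂ) :=
  ⟨fun z => ((z ^ n : Circle) : ℂ),
    (show Continuous fun z : Circle => (z : ℂ) by fun_prop).comp (continuous_zpow n)⟩

/-- `H_p(X)`: the functions in `L_p(𝕋, X)` whose Fourier coefficients
`∫ f(w) w^{-n} dw` vanish for all `n < 0`. -/
def HardyCircle (p : ℝ≥0∞) [Fact (1 ≤ p)] (X : Type*) [NormedAddCommGroup X] [NormedSpace ℂ X] :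
    Submodule ℂ (Lp X p (haarProb Circle)) where
  carrier := {f | ∀ n : ℤ, n < 0 → pairing p (circleMonomial (-n)) f = 0}
  zero_mem' := fun _ _ => map_zero _
  add_mem' := fun hf hg n hn => by rw [map_add, hf n hn, hg n hn, add_zero]
  smul_mem' := fun c f hf n hn => by rw [map_smul, hf n hn, smul_zero]

/-- The function `z ↦ φ(z) x`. -/
def vectorMul {G X : Type*} [TopologicalSpace G] [NormedAddCommGroup X] [NormedSpace ℂ X]
    (φ : C(G, ℂ)) (x : X) : C(G, X) :=
  ⟨fun z => φ z • x, by fun_prop⟩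

theorem pairing_toLp_vectorMul {G : Type*} [Group G] [TopologicalSpace G] [IsTopologicalGroup G]
    [CompactSpace G] [SecondCountableTopology G] [MeasurableSpace G] [BorelSpace G]
    {X : Type*} [NormedAddCommGroup X] [NormedSpace ℂ X] [CompleteSpace X]
    (p : ℝ≥0∞) [Fact (1 ≤ p)] (φ ψ : C(G, ℂ)) (x : X) :
    pairing p φ (ContinuousMap.toLp p (haarProb G) ℂ (vectorMul ψ x)) =
      (∫ w, φ w * ψ w ∂(haarProb G)) • x := by
  rw [← integral_smul_const]
  refine integral_congr_ae ?_
  filter_upwards [ContinuousMap.coeFn_toLp (p := p) (𝕜 := ℂ) (haarProb G) (vectorMul ψ x)]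
    with w hw
  rw [hw]
  simp [vectorMul, smul_smul]

theorem circleMonomial_orthogonal (m n : ℤ) (h : m + n ≠ 0) :
    ∫ w, circleMonomial m w * circleMonomial n w ∂(haarProb Circle) = 0 := by
  have key := integral_character_eq_zero (G := Circle) (zpowGroupHom (m + n)) ?_
  · rw [← key]
    refine integral_congr_ae (Filter.Eventually.of_forall fun w => ?_)
    simp only [circleMonomial, ContinuousMap.coe_mk, zpowGroupHom_apply, zpow_add, Circle.coe_mul]
  · refine ⟨Circle.exp (Real.pi / (m + n : ℤ)), ?_⟩
    intro h1
    rw [zpowGroupHom_apply, ← Circle.exp_zsmul] at h1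
    have h2 : ((m + n : ℤ) : ℝ) ≠ 0 := by exact_mod_cast h
    rw [zsmul_eq_mul, mul_div_cancel₀ _ h2] at h1
    have h3 := congrArg (fun z : Circle => (z : ℂ)) h1
    simp only [Circle.coe_exp, Complex.exp_pi_mul_I, Circle.coe_one] at h3
    norm_num at h3

/-- The element `x zⁿ` of `H_p(X)`, `n ≥ 0`. -/
def powerTerm (p : ℝ≥0∞) [Fact (1 ≤ p)] {X : Type*} [NormedAddCommGroup X] [NormedSpace ℂ X]
    [CompleteSpace X] (x : X) (n : ℕ) : HardyCircle p X :=
  ⟨ContinuousMap.toLp p (haarProb Circle) ℂ (vectorMul (circleMonomial n) x), by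
    intro m hm
    rw [pairing_toLp_vectorMul, circleMonomial_orthogonal _ _ (by omega), zero_smul]⟩

/-! ### The infinite polytorus `𝕋^ℕ` and the space `H_p(𝕋^ℕ, X)` -/

/-- `z ↦ z^α = ∏ₖ zₖ^{αₖ}` on `𝕋^ℕ`, as a character. -/
def torusCharacter (α : ℕ →₀ ℤ) : (ℕ → Circle) →* Circle where
  toFun z := α.prod fun k e => z k ^ e
  map_one' := by simp
  map_mul' z w := by simp [mul_zpow, Finsupp.prod_mul]

/-- `z ↦ z^α = ∏ₖ zₖ^{αₖ}` on `𝕋^ℕ`, as a continuous complex function. -/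
def torusMonomial (α : ℕ →₀ ℤ) : C(ℕ → Circle, ℂ) :=
  ⟨fun z => (torusCharacter α z : ℂ), by
    simp only [torusCharacter, MonoidHom.coe_mk, OneHom.coe_mk, Finsupp.prod]
    fun_prop⟩

theorem torusMonomial_add (α β : ℕ →₀ ℤ) :
    torusMonomial (α + β) = torusMonomial α * torusMonomial β := by
  ext z
  simp only [torusMonomial, torusCharacter, ContinuousMap.coe_mk, ContinuousMap.mul_apply,
    MonoidHom.coe_mk, OneHom.coe_mk, ← Circle.coe_mul]
  rw [Finsupp.prod_add_index' (fun _ => zpow_zero _) (fun _ _ _ => zpow_add _ _ _)]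

theorem torusMonomial_zero : torusMonomial 0 = 1 := by
  ext z
  simp [torusMonomial, torusCharacter]

theorem torusCharacter_single (k : ℕ) (e : ℤ) (z : ℕ → Circle) :
    torusCharacter (Finsupp.single k e) z = z k ^ e := by
  simp [torusCharacter]

theorem star_torusMonomial (α : ℕ →₀ ℤ) : star (torusMonomial α) = torusMonomial (-α) := by
  ext z
  simp only [torusMonomial, ContinuousMap.star_apply, ContinuousMap.coe_mk]
  rw [← starRingEnd_apply, ← Circle.coe_inv_eq_conj]
  congr 1
  simp only [torusCharacter, MonoidHom.coe_mk, OneHom.coe_mk]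
  rw [Finsupp.prod_neg_index (by simp)]
  simp only [zpow_neg, Finsupp.prod, Finset.prod_inv_distrib]
  rfl

theorem torusMonomial_orthogonal (α β : ℕ →₀ ℤ) (h : α + β ≠ 0) :
    ∫ w, torusMonomial α w * torusMonomial β w ∂(haarProb (ℕ → Circle)) = 0 := by
  have key := integral_character_eq_zero (G := ℕ → Circle) (torusCharacter (α + β)) ?_
  · rw [← key]
    refine integral_congr_ae (Filter.Eventually.of_forall fun w => ?_)
    have := congrArg (fun f : C(ℕ → Circle, ℂ) => f w) (torusMonomial_add α β)
    simpa [torusMonomial] using this.symm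
  · obtain ⟨k, hk⟩ := Finsupp.ne_iff.1 h
    refine ⟨Pi.mulSingle k (Circle.exp (Real.pi / ((α + β) k : ℤ))), ?_⟩
    have h1 : torusCharacter (α + β) (Pi.mulSingle k (Circle.exp (Real.pi / ((α + β) k : ℤ)))) =
        Circle.exp (Real.pi / ((α + β) k : ℤ)) ^ ((α + β) k) := by
      simp only [torusCharacter, MonoidHom.coe_mk, OneHom.coe_mk]
      rw [Finsupp.prod, Finset.prod_eq_single k]
      · rw [Pi.mulSingle_eq_same]
      · intro j _ hj
        rw [Pi.mulSingle_eq_of_ne hj, one_zpow]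
      · intro hk'
        rw [Finsupp.notMem_support_iff.1 hk', zpow_zero]
    rw [h1, ← Circle.exp_zsmul]
    have h2 : (((α + β) k : ℤ) : ℝ) ≠ 0 := by exact_mod_cast hk
    rw [zsmul_eq_mul, mul_div_cancel₀ _ h2]
    intro h3
    have h4 := congrArg (fun z : Circle => (z : ℂ)) h3
    simp only [Circle.coe_exp, Complex.exp_pi_mul_I, Circle.coe_one] at h4
    norm_num at h4

/-- The trigonometric polynomials on `𝕋^ℕ`, as a star subalgebra of the continuous functions. -/
def torusPolynomials : StarSubalgebra ℂ C(ℕ → Circle, ℂ) where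
  toSubalgebra := Algebra.adjoin ℂ (Set.range torusMonomial)
  star_mem' := by
    change Algebra.adjoin ℂ (Set.range torusMonomial) ≤
      star (Algebra.adjoin ℂ (Set.range torusMonomial))
    refine Algebra.adjoin_le ?_
    rintro - ⟨α, rfl⟩
    change star (torusMonomial α) ∈ Algebra.adjoin ℂ (Set.range torusMonomial)
    rw [star_torusMonomial]
    exact Algebra.subset_adjoin ⟨-α, rfl⟩

theorem torusPolynomials_coe :
    Subalgebra.toSubmodule torusPolynomials.toSubalgebra =
      Submodule.span ℂ (Set.range torusMonomial) := by
  apply Algebra.adjoin_eq_span_of_subset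
  refine Set.Subset.trans ?_ Submodule.subset_span
  intro x hx
  refine Submonoid.closure_induction (fun _ => id) ⟨0, torusMonomial_zero⟩ ?_ hx
  rintro - - - - ⟨m, rfl⟩ ⟨n, rfl⟩
  exact ⟨m + n, torusMonomial_add m n⟩

theorem torusPolynomials_closure : torusPolynomials.topologicalClosure = ⊤ := by
  refine ContinuousMap.starSubalgebra_topologicalClosure_eq_top_of_separatesPoints _ ?_
  intro x y hxy
  obtain ⟨k, hk⟩ := Function.ne_iff.1 hxy
  refine ⟨_, ⟨torusMonomial (Finsupp.single k 1), Algebra.subset_adjoin ⟨_, rfl⟩, rfl⟩, ?_⟩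
  simp only [torusMonomial, ContinuousMap.coe_mk, torusCharacter_single, zpow_one]
  exact fun h => hk (Circle.ext h)

section Polytorus

variable (p : ℝ≥0∞) [Fact (1 ≤ p)] (X : Type*) [NormedAddCommGroup X] [NormedSpace ℂ X]

/-- The Fourier coefficient `∫ f(w) w^{-α} dw` of `f ∈ L_p(𝕋^ℕ, X)`. -/
def torusCoeff (α : ℕ →₀ ℤ) : Lp X p (haarProb (ℕ → Circle)) →ₗ[ℂ] X :=
  pairing p (torusMonomial (-α))

variable {p X} in
/-- A function in `L_p(𝕋^ℕ, X)` is determined by its Fourier coefficients. -/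
theorem eq_zero_of_torusCoeff_eq_zero [CompleteSpace X] (f : Lp X p (haarProb (ℕ → Circle)))
    (h : ∀ α, torusCoeff p X α f = 0) : f = 0 := by
  have hint := integrable_Lp f
  refine (Lp.eq_zero_iff_ae_eq_zero).2 (ae_eq_zero_of_integral_continuous_smul hint ?_)
  let I : C(ℕ → Circle, ℂ) →ₗ[ℂ] X :=
    { toFun := fun φ => ∫ w, φ w • f w ∂(haarProb (ℕ → Circle))
      map_add' := fun φ ψ => by
        simp only [ContinuousMap.add_apply, add_smul]
        exact integral_add (integrable_continuous_smul φ hint) (integrable_continuous_smul ψ hint)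
      map_smul' := fun c φ => by
        simp only [ContinuousMap.smul_apply, smul_assoc, RingHom.id_apply]
        exact integral_smul c _ }
  have hI : Continuous I := by
    refine (I.mkContinuous (∫ w, ‖f w‖ ∂(haarProb (ℕ → Circle))) fun φ => ?_).continuous
    calc ‖∫ w, φ w • f w ∂(haarProb (ℕ → Circle))‖
        ≤ ∫ w, ‖φ‖ * ‖f w‖ ∂(haarProb (ℕ → Circle)) := by
          refine norm_integral_le_of_norm_le (hint.norm.const_mul _)
            (Filter.Eventually.of_forall fun w => ?_)
          rw [norm_smul]
          exact mul_le_mul_of_nonneg_right (φ.norm_coe_le_norm w) (norm_nonneg _)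
      _ = (∫ w, ‖f w‖ ∂(haarProb (ℕ → Circle))) * ‖φ‖ := by
          rw [integral_const_mul, mul_comm]
  have hspan : Submodule.span ℂ (Set.range torusMonomial) ≤ LinearMap.ker I := by
    rw [Submodule.span_le]
    rintro - ⟨α, rfl⟩
    have := h (-α)
    rw [torusCoeff, neg_neg] at this
    exact this
  intro φ
  have hφ : φ ∈ closure (torusPolynomials : Set C(ℕ → Circle, ℂ)) := by
    rw [← StarSubalgebra.topologicalClosure_coe, torusPolynomials_closure]
    trivial
  have hsub : (torusPolynomials : Set C(ℕ → Circle, ℂ)) ⊆ I ⁻¹' {0} := by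
    intro ψ hψ
    have : ψ ∈ Subalgebra.toSubmodule torusPolynomials.toSubalgebra := hψ
    rw [torusPolynomials_coe] at this
    exact hspan this
  exact closure_minimal hsub (isClosed_singleton.preimage hI) hφ

/-- `H_p(𝕋^ℕ, X)`: the functions in `L_p(𝕋^ℕ, X)` whose Fourier coefficients vanish at every
multi-index that has a negative entry. -/
def HardyTorus : Submodule ℂ (Lp X p (haarProb (ℕ → Circle))) where
  carrier := {f | ∀ α : ℕ →₀ ℤ, (∃ k, α k < 0) → torusCoeff p X α f = 0}
  zero_mem' := fun _ _ => map_zero _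
  add_mem' := fun hf hg α hα => by rw [map_add, hf α hα, hg α hα, add_zero]
  smul_mem' := fun c f hf α hα => by rw [map_smul, hf α hα, smul_zero]

end Polytorus

/-! ### Bohr's correspondence and the space `𝓗_p(X)` of Dirichlet series -/

/-- `α(n)`: the exponents in `n = p₀^{α₀} p₁^{α₁} ⋯`, where `p₀ < p₁ < ⋯` are the primes. -/
def bohrExponent (n : ℕ+) : ℕ →₀ ℕ :=
  (n : ℕ).factorization.comapDomain (Nat.nth Nat.Prime)
    (Nat.nth_injective Nat.infinite_setOfPred_prime).injOn

/-- `α(n)`, as a multi-index of integers. -/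
def bohrIndex (n : ℕ+) : ℕ →₀ ℤ :=
  (bohrExponent n).mapRange (fun k : ℕ => (k : ℤ)) Nat.cast_zero

theorem bohrExponent_apply (n : ℕ+) (k : ℕ) :
    bohrExponent n k = (n : ℕ).factorization (Nat.nth Nat.Prime k) := rfl

theorem bohrIndex_apply (n : ℕ+) (k : ℕ) :
    bohrIndex n k = ((n : ℕ).factorization (Nat.nth Nat.Prime k) : ℤ) := rfl

theorem bohrExponent_injective : Function.Injective bohrExponent := by
  intro m n h
  refine PNat.eq (Nat.eq_of_factorization_eq m.ne_zero n.ne_zero fun q => ?_)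
  by_cases hq : q.Prime
  · have := DFunLike.congr_fun h (Nat.count Nat.Prime q)
    rwa [bohrExponent_apply, bohrExponent_apply, Nat.nth_count hq] at this
  · rw [Nat.factorization_eq_zero_of_not_prime _ hq, Nat.factorization_eq_zero_of_not_prime _ hq]

theorem bohrIndex_injective : Function.Injective bohrIndex := fun _ _ h =>
  bohrExponent_injective (Finsupp.mapRange_injective _ _ Nat.cast_injective h)

/-- `n(α) = ∏ₖ pₖ^{αₖ}`. -/
def bohrNumber (α : ℕ →₀ ℕ) : ℕ+ :=
  ⟨α.prod fun k e => Nat.nth Nat.Prime k ^ e,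
    Finset.prod_pos fun k _ => pow_pos (Nat.prime_nth_prime k).pos _⟩

theorem bohrExponent_bohrNumber (α : ℕ →₀ ℕ) : bohrExponent (bohrNumber α) = α := by
  ext k
  rw [bohrExponent_apply]
  simp only [bohrNumber, PNat.mk_coe, Finsupp.prod]
  rw [Nat.factorization_prod fun j _ => pow_ne_zero _ (Nat.prime_nth_prime j).ne_zero,
    Finset.sum_apply']
  simp only [(Nat.prime_nth_prime _).factorization_pow, Finsupp.single_apply,
    (Nat.nth_injective Nat.infinite_setOfPred_prime).eq_iff]
  simp only [Finset.sum_ite_eq', Finsupp.mem_support_iff]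
  by_cases h : α k = 0 <;> simp [h]

section Dirichlet

variable (p : ℝ≥0∞) [Fact (1 ≤ p)] (X : Type*) [NormedAddCommGroup X] [NormedSpace ℂ X]

/-- Bohr's transform: it sends `f ∈ H_p(𝕋^ℕ, X)` to the Dirichlet series `∑ xₙ n^{-s}` whose
`n`-th coefficient `xₙ` is the Fourier coefficient of `f` at `α(n)`. A (formal) Dirichlet series
is the sequence of its coefficients. -/
def bohrTransform : HardyTorus p X →ₗ[ℂ] (ℕ+ → X) :=
  (LinearMap.pi fun n => torusCoeff p X (bohrIndex n)).comp (HardyTorus p X).subtype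

theorem bohrTransform_injective [CompleteSpace X] : Function.Injective (bohrTransform p X) := by
  rw [injective_iff_map_eq_zero]
  intro f hf
  refine Subtype.ext (eq_zero_of_torusCoeff_eq_zero _ fun α => ?_)
  by_cases hα : ∃ k, α k < 0
  · exact f.2 α hα
  · simp only [not_exists, not_lt] at hα
    have h1 : bohrIndex (bohrNumber (α.mapRange Int.toNat rfl)) = α := by
      ext k
      rw [bohrIndex, bohrExponent_bohrNumber]
      simpa using hα k
    have h2 := congrFun hf (bohrNumber (α.mapRange Int.toNat rfl))
    rw [← h1]
    exact h2

variable [CompleteSpace X]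

/-- `𝓗_p(X)`: the Dirichlet series in the image of `H_p(𝕋^ℕ, X)` under Bohr's transform. -/
def HardyDirichlet : Type _ := ↥(LinearMap.range (bohrTransform p X))

instance HardyDirichlet.addCommGroup : AddCommGroup (HardyDirichlet p X) :=
  inferInstanceAs (AddCommGroup ↥(LinearMap.range (bohrTransform p X)))

instance HardyDirichlet.module : Module ℂ (HardyDirichlet p X) :=
  inferInstanceAs (Module ℂ ↥(LinearMap.range (bohrTransform p X)))

/-- Bohr's transform as a bijection of `H_p(𝕋^ℕ, X)` with `𝓗_p(X)`. -/
def bohrEquiv : HardyTorus p X ≃ₗ[ℂ] HardyDirichlet p X :=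
  LinearEquiv.ofInjective (bohrTransform p X) (bohrTransform_injective p X)

/-- The norm of `𝓗_p(X)` is the one that makes Bohr's transform an isometry. -/
instance HardyDirichlet.normedAddCommGroup : NormedAddCommGroup (HardyDirichlet p X) :=
  NormedAddCommGroup.induced _ _ (bohrEquiv p X).symm (bohrEquiv p X).symm.injective

instance HardyDirichlet.normedSpace : NormedSpace ℂ (HardyDirichlet p X) :=
  NormedSpace.induced _ _ _ (bohrEquiv p X).symm

theorem HardyDirichlet.norm_def (D : HardyDirichlet p X) : ‖D‖ = ‖(bohrEquiv p X).symm D‖ := rfl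

theorem norm_bohrEquiv (f : HardyTorus p X) : ‖bohrEquiv p X f‖ = ‖f‖ := by
  rw [HardyDirichlet.norm_def, LinearEquiv.symm_apply_apply]

variable {X}

/-- The element `x z^{α(n)}` of `H_p(𝕋^ℕ, X)`. -/
def torusTerm (x : X) (n : ℕ+) : HardyTorus p X :=
  ⟨ContinuousMap.toLp p (haarProb (ℕ → Circle)) ℂ (vectorMul (torusMonomial (bohrIndex n)) x), by
    intro α hα
    rw [torusCoeff, pairing_toLp_vectorMul, torusMonomial_orthogonal, zero_smul]
    intro h
    obtain ⟨k, hk⟩ := hα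
    have h1 := DFunLike.congr_fun h k
    rw [Finsupp.add_apply, Finsupp.neg_apply, Finsupp.zero_apply, bohrIndex_apply] at h1
    omega⟩

theorem bohrTransform_torusTerm (x : X) (n : ℕ+) :
    bohrTransform p X (torusTerm p x n) = Pi.single n x := by
  ext m
  change torusCoeff p X (bohrIndex m) (ContinuousMap.toLp p (haarProb (ℕ → Circle)) ℂ
    (vectorMul (torusMonomial (bohrIndex n)) x)) = _
  rw [torusCoeff, pairing_toLp_vectorMul]
  by_cases h : m = n
  · subst h
    have : ∀ w, torusMonomial (-bohrIndex m) w * torusMonomial (bohrIndex m) w = 1 := by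
      intro w
      rw [← ContinuousMap.mul_apply, ← torusMonomial_add, neg_add_cancel, torusMonomial_zero,
        ContinuousMap.one_apply]
    simp [this]
  · rw [torusMonomial_orthogonal, zero_smul, Pi.single_eq_of_ne h]
    intro h1
    exact h (bohrIndex_injective (neg_add_eq_zero.1 h1))

/-- The element `x n^{-s}` of `𝓗_p(X)`: the Dirichlet series whose only nonzero coefficient is
the `n`-th one, which is `x`. -/
def dirichletTerm (x : X) (n : ℕ+) : HardyDirichlet p X :=
  ⟨Pi.single n x, torusTerm p x n, bohrTransform_torusTerm p x n⟩

theorem bohrEquiv_torusTerm (x : X) (n : ℕ+) :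
    bohrEquiv p X (torusTerm p x n) = dirichletTerm p x n :=
  Subtype.ext (bohrTransform_torusTerm p x n)

end Dirichlet

/-! ### Random unconditional convergence -/

/-- `𝔼 ‖∑ εᵢ yᵢ‖`, the average over all choices of signs `εᵢ = ±1`. -/
def rademacherMean {E : Type*} [NormedAddCommGroup E] {m : ℕ} (y : Fin m → E) : ℝ :=
  (1 / 2 ^ m) * ∑ ε : Fin m → ℤˣ, ‖∑ i, ((ε i : ℤˣ) : ℤ) • y i‖

/-- The sequence `e₁, e₂, …` is RUC: there is a constant `C` such that
`𝔼 ‖∑_{n ≤ m} εₙ aₙ eₙ‖ ≤ C ‖∑_{n ≤ m} aₙ eₙ‖` for all `m` and all scalars `a₁, …, aₘ`. -/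
def IsRUC {E : Type*} [NormedAddCommGroup E] [NormedSpace ℂ E] (e : ℕ+ → E) : Prop :=
  ∃ C : ℝ, ∀ (m : ℕ) (a : Fin m → ℂ),
    rademacherMean (fun i : Fin m => a i • e (Nat.succPNat i)) ≤
      C * ‖∑ i : Fin m, a i • e (Nat.succPNat i)‖

/-! ### The example -/

/-- The Banach space `L_1(𝕋²)`. -/
abbrev LOneTorus : Type := Lp ℂ 1 (haarProb (Circle × Circle))

/-- The element `(w₁, w₂) ↦ w₁^j w₂^l` of `L_1(𝕋²)`. -/
def torusTwoMonomial (j l : ℕ) : LOneTorus :=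
  ContinuousMap.toLp 1 (haarProb (Circle × Circle)) ℂ
    ⟨fun w => (w.1 : ℂ) ^ j * (w.2 : ℂ) ^ l, by fun_prop⟩

open Classical in
/-- `xₙ(w₁, w₂) = w₁^k` if `n = 2^k`, and `xₙ(w₁, w₂) = w₂^{2^n}` otherwise. -/
def powerRUCSeq (n : ℕ+) : LOneTorus :=
  if h : ∃ k : ℕ, (n : ℕ) = 2 ^ k then torusTwoMonomial h.choose 0
  else torusTwoMonomial 0 (2 ^ (n : ℕ))

theorem powerRUCSeq_of_eq {n : ℕ+} {k : ℕ} (hn : (n : ℕ) = 2 ^ k) :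
    powerRUCSeq n = torusTwoMonomial k 0 := by
  have h : ∃ k : ℕ, (n : ℕ) = 2 ^ k := ⟨k, hn⟩
  rw [powerRUCSeq, dif_pos h,
    Nat.pow_right_injective le_rfl (h.choose_spec.symm.trans hn)]

theorem powerRUCSeq_of_ne {n : ℕ+} (hn : ∀ k : ℕ, (n : ℕ) ≠ 2 ^ k) :
    powerRUCSeq n = torusTwoMonomial 0 (2 ^ (n : ℕ)) := by
  rw [powerRUCSeq, dif_neg (by simpa using hn)]

end

/-! Everything is measured against the `ℓ_2` norm of the coefficients. The norm of `L_2(G, L_1(H))`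
lies between those of `L_1(G × H)` and `L_2(G × H)`, and signs do not affect the modulus of a
coefficient.

For power series, `x_n z^n` is a character of `𝕋³` with frequency `(2^k, k, 0)` if `n = 2^k`, and
`(n, 0, 2^n)` otherwise. These frequencies form a Sidon set (`frequencies_sidon`): a sum of two of
them determines the pair. Fourth moments are then controlled by second moments, so the `L_1(𝕋³)`
norm dominates half the `ℓ_2` norm (`sqrt_sum_sq_le_integral_norm_sum`). Every signed sum has norm
at most the `ℓ_2` norm, by Parseval, and RUC follows with constant 2.

For Dirichlet series, Bohr's correspondence replaces `2^k` by the monomial `z_0^k`, and the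
lacunarity in `z` is lost. A sum supported on powers of two becomes `∑ b_k (z_0 w_1)^k`, whose norm,
by rotation invariance, is the `L_1(𝕋)` norm of `∑ b_k w^k`. Random signs still produce at least
half the `ℓ_2` norm, by Khinchin's inequality applied pointwise
(`sqrt_sum_sq_le_rademacherMean_toLp`). RUC would thus bound `ℓ_2` norms by `L_1` norms for all
polynomials on the circle.

No such bound exists: squares of Dirichlet kernels violate it
(`not_exists_sqrt_sum_sq_le_integral_norm_sum_pow`). Through Parseval this is also the third claim.
-/

/-! ### Orthogonal families of unimodular functions -/

section Orthogonal

variable {Ω : Type*} [MeasurableSpace Ω] {μ : Measure Ω} [IsProbabilityMeasure μ]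
  {ι : Type*} [Fintype ι] {φ : ι → Ω → ℂ}

/-- Parseval's identity for an orthogonal family of unimodular functions. -/
theorem integral_norm_sq_sum_of_orthogonal (hm : ∀ i, AEStronglyMeasurable (φ i) μ)
    (h1 : ∀ i x, ‖φ i x‖ = 1)
    (h2 : ∀ i j, i ≠ j → ∫ x, φ i x * starRingEnd ℂ (φ j x) ∂μ = 0) (a : ι → ℂ) :
    ∫ x, ‖∑ i, a i * φ i x‖ ^ 2 ∂μ = ∑ i, ‖a i‖ ^ 2 := by
  classical
  have hint : ∀ i j, Integrable (fun x => φ i x * starRingEnd ℂ (φ j x)) μ := fun i j =>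
    Integrable.of_bound ((hm i).mul (RCLike.continuous_conj.comp_aestronglyMeasurable (hm j))) 1
      (Filter.Eventually.of_forall fun x => by simp [h1])
  have hexp : ∀ x, (((‖∑ i, a i * φ i x‖ ^ 2 : ℝ)) : ℂ) =
      ∑ i, ∑ j, a i * starRingEnd ℂ (a j) * (φ i x * starRingEnd ℂ (φ j x)) := by
    intro x
    rw [Complex.ofReal_pow, ← Complex.mul_conj', map_sum, Finset.sum_mul_sum]
    refine Finset.sum_congr rfl fun i _ => Finset.sum_congr rfl fun j _ => ?_
    rw [map_mul]
    ring
  have hdiag : ∀ i j, ∫ x, φ i x * starRingEnd ℂ (φ j x) ∂μ = if i = j then 1 else 0 := by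
    intro i j
    split_ifs with h
    · subst h
      simp [Complex.mul_conj', h1]
    · exact h2 i j h
  apply Complex.ofReal_injective
  rw [← integral_complex_ofReal]
  simp only [hexp]
  rw [integral_finsetSum _ fun i _ => integrable_finsetSum _ fun j _ => (hint i j).const_mul _]
  simp only [integral_finsetSum Finset.univ fun j _ => (hint _ j).const_mul _,
    integral_const_mul, hdiag]
  simp [Complex.mul_conj']

/-- If the products of four members of a family of unimodular functions integrate to zero except
when they cancel in pairs, then the fourth moments are controlled by the second ones. -/
theorem integral_norm_pow_four_sum_le (hm : ∀ i, AEStronglyMeasurable (φ i) μ)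
    (h1 : ∀ i x, ‖φ i x‖ = 1)
    (h4 : ∀ i j k l, ¬ (i = k ∧ j = l) → ¬ (i = l ∧ j = k) → ¬ (i = j ∧ k = l) →
      ∫ x, φ i x * φ j x * starRingEnd ℂ (φ k x * φ l x) ∂μ = 0) (a : ι → ℂ) :
    ∫ x, ‖∑ i, a i * φ i x‖ ^ 4 ∂μ ≤ 3 * (∑ i, ‖a i‖ ^ 2) ^ 2 := by
  classical
  have hint : ∀ i j k l, Integrable (fun x => φ i x * φ j x * starRingEnd ℂ (φ k x * φ l x)) μ :=
    fun i j k l => Integrable.of_bound (((hm i).mul (hm j)).mul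
      (RCLike.continuous_conj.comp_aestronglyMeasurable ((hm k).mul (hm l)))) 1
      (Filter.Eventually.of_forall fun x => by simp [h1])
  have hexp : ∀ x, (((‖∑ i, a i * φ i x‖ ^ 4 : ℝ)) : ℂ) =
      ∑ i, ∑ j, ∑ k, ∑ l, a i * a j * starRingEnd ℂ (a k * a l) *
        (φ i x * φ j x * starRingEnd ℂ (φ k x * φ l x)) := by
    intro x
    have : ‖∑ i, a i * φ i x‖ ^ 4 = ‖(∑ i, a i * φ i x) * ∑ i, a i * φ i x‖ ^ 2 := by
      rw [norm_mul]
      ring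
    rw [this, Complex.ofReal_pow, ← Complex.mul_conj', map_mul, map_sum]
    simp only [Finset.sum_mul_sum]
    refine Finset.sum_congr rfl fun i _ => ?_
    rw [Finset.sum_comm]
    refine Finset.sum_congr rfl fun j _ => Finset.sum_congr rfl fun k _ =>
      Finset.sum_congr rfl fun l _ => ?_
    simp only [map_mul]
    ring
  -- Each of the three ways of pairing four indices gets one indicator product. After summation
  -- against the coefficients each contributes `(∑ ‖a i‖ ^ 2) ^ 2`, whence the factor 3. The pairing
  -- `i = j`, `k = l` is there for real signs, whose squares are 1.
  have hbound : ∀ i j k l, ‖∫ x, φ i x * φ j x * starRingEnd ℂ (φ k x * φ l x) ∂μ‖ ≤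
      (if i = k then 1 else 0) * (if j = l then 1 else 0) +
      (if i = l then 1 else 0) * (if j = k then 1 else 0) +
      (if i = j then 1 else 0) * (if k = l then (1 : ℝ) else 0) := by
    intro i j k l
    by_cases h : (i = k ∧ j = l) ∨ (i = l ∧ j = k) ∨ (i = j ∧ k = l)
    · have hle : ‖∫ x, φ i x * φ j x * starRingEnd ℂ (φ k x * φ l x) ∂μ‖ ≤ 1 := by
        refine (norm_integral_le_of_norm_le_const (C := 1)
          (Filter.Eventually.of_forall fun x => by simp [h1])).trans ?_
        simp
      refine hle.trans ?_
      have p : ∀ (q : Prop) [Decidable q], (0 : ℝ) ≤ if q then 1 else 0 := by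
        intro q _
        split_ifs <;> norm_num
      have p1 := mul_nonneg (p (i = k)) (p (j = l))
      have p2 := mul_nonneg (p (i = l)) (p (j = k))
      have p3 := mul_nonneg (p (i = j)) (p (k = l))
      rcases h with h | h | h
      · have : (if i = k then 1 else 0) * (if j = l then 1 else 0) = (1 : ℝ) := by simp [h]
        linarith
      · have : (if i = l then 1 else 0) * (if j = k then 1 else 0) = (1 : ℝ) := by simp [h]
        linarith
      · have : (if i = j then 1 else 0) * (if k = l then 1 else 0) = (1 : ℝ) := by simp [h]
        linarith
    · simp only [not_or] at h
      rw [h4 i j k l h.1 h.2.1 h.2.2, norm_zero]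
      positivity
  have hI : ((∫ x, ‖∑ i, a i * φ i x‖ ^ 4 ∂μ : ℝ) : ℂ) =
      ∑ i, ∑ j, ∑ k, ∑ l, a i * a j * starRingEnd ℂ (a k * a l) *
        ∫ x, φ i x * φ j x * starRingEnd ℂ (φ k x * φ l x) ∂μ := by
    rw [← integral_complex_ofReal]
    simp only [hexp]
    have i1 := fun i j k l => (hint i j k l).const_mul (a i * a j * starRingEnd ℂ (a k * a l))
    have i2 := fun i j k => integrable_finsetSum Finset.univ fun l _ => i1 i j k l
    have i3 := fun i j => integrable_finsetSum Finset.univ fun k _ => i2 i j k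
    have i4 := fun i => integrable_finsetSum Finset.univ fun j _ => i3 i j
    rw [integral_finsetSum _ fun i _ => i4 i]
    refine Finset.sum_congr rfl fun i _ => ?_
    rw [integral_finsetSum _ fun j _ => i3 i j]
    refine Finset.sum_congr rfl fun j _ => ?_
    rw [integral_finsetSum _ fun k _ => i2 i j k]
    refine Finset.sum_congr rfl fun k _ => ?_
    rw [integral_finsetSum _ fun l _ => i1 i j k l]
    exact Finset.sum_congr rfl fun l _ => integral_const_mul _ _
  have hnn : 0 ≤ ∫ x, ‖∑ i, a i * φ i x‖ ^ 4 ∂μ := integral_nonneg fun x => by positivity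
  calc ∫ x, ‖∑ i, a i * φ i x‖ ^ 4 ∂μ
      = ‖((∫ x, ‖∑ i, a i * φ i x‖ ^ 4 ∂μ : ℝ) : ℂ)‖ := by
        rw [Complex.norm_real, Real.norm_of_nonneg hnn]
    _ ≤ ∑ i, ∑ j, ∑ k, ∑ l, ‖a i‖ * ‖a j‖ * (‖a k‖ * ‖a l‖) *
        ((if i = k then 1 else 0) * (if j = l then 1 else 0) +
        (if i = l then 1 else 0) * (if j = k then 1 else 0) +
        (if i = j then 1 else 0) * (if k = l then (1 : ℝ) else 0)) := by
        rw [hI]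
        refine norm_sum_le_of_le _ fun i _ => norm_sum_le_of_le _ fun j _ =>
          norm_sum_le_of_le _ fun k _ => norm_sum_le_of_le _ fun l _ => ?_
        rw [norm_mul]
        refine mul_le_mul (le_of_eq (by simp)) (hbound i j k l) (norm_nonneg _) (by positivity)
    _ = 3 * (∑ i, ‖a i‖ ^ 2) ^ 2 := by
        simp only [mul_add, Finset.sum_add_distrib]
        have e1 : ∀ i j, ∑ k, ∑ l, ‖a i‖ * ‖a j‖ * (‖a k‖ * ‖a l‖) *
            ((if i = k then 1 else 0) * (if j = l then (1 : ℝ) else 0)) =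
            ‖a i‖ ^ 2 * ‖a j‖ ^ 2 := by
          intro i j
          simp only [← mul_assoc, mul_ite, mul_one, mul_zero, Finset.sum_ite_eq,
            Finset.mem_univ, if_true]
          ring
        have e2 : ∀ i j, ∑ k, ∑ l, ‖a i‖ * ‖a j‖ * (‖a k‖ * ‖a l‖) *
            ((if i = l then 1 else 0) * (if j = k then (1 : ℝ) else 0)) =
            ‖a i‖ ^ 2 * ‖a j‖ ^ 2 := by
          intro i j
          rw [Finset.sum_comm]
          have e : ∀ l k, ‖a i‖ * ‖a j‖ * (‖a k‖ * ‖a l‖) *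
              ((if i = l then 1 else 0) * (if j = k then (1 : ℝ) else 0)) =
              if j = k then (if i = l then ‖a i‖ * ‖a j‖ * (‖a k‖ * ‖a l‖) else 0) else 0 := by
            intro l k
            split_ifs <;> ring
          simp only [e, Finset.sum_ite_eq, Finset.mem_univ, if_true]
          ring
        have e3 : ∑ i, ∑ j, ∑ k, ∑ l, ‖a i‖ * ‖a j‖ * (‖a k‖ * ‖a l‖) *
            ((if i = j then 1 else 0) * (if k = l then (1 : ℝ) else 0)) =
            ∑ i, ∑ k, ‖a i‖ ^ 2 * ‖a k‖ ^ 2 := by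
          refine Finset.sum_congr rfl fun i _ => ?_
          rw [Finset.sum_comm]
          refine Finset.sum_congr rfl fun k _ => ?_
          have e : ∀ j l, ‖a i‖ * ‖a j‖ * (‖a k‖ * ‖a l‖) *
              ((if i = j then 1 else 0) * (if k = l then (1 : ℝ) else 0)) =
              if k = l then (if i = j then ‖a i‖ * ‖a j‖ * (‖a k‖ * ‖a l‖) else 0) else 0 := by
            intro j l
            split_ifs <;> ring
          simp only [e, Finset.sum_ite_eq, Finset.mem_univ, if_true]
          ring
        simp only [e1, e2, e3]
        rw [sq, Finset.sum_mul_sum]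
        ring

/-- A Khinchin type inequality between the `L_1` and the `L_2` norm. -/
theorem sqrt_sum_sq_le_integral_norm_sum (hm : ∀ i, AEStronglyMeasurable (φ i) μ)
    (h1 : ∀ i x, ‖φ i x‖ = 1)
    (h2 : ∀ i j, i ≠ j → ∫ x, φ i x * starRingEnd ℂ (φ j x) ∂μ = 0)
    (h4 : ∀ i j k l, ¬ (i = k ∧ j = l) → ¬ (i = l ∧ j = k) → ¬ (i = j ∧ k = l) →
      ∫ x, φ i x * φ j x * starRingEnd ℂ (φ k x * φ l x) ∂μ = 0) (a : ι → ℂ) :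
    √(∑ i, ‖a i‖ ^ 2) ≤ 2 * ∫ x, ‖∑ i, a i * φ i x‖ ∂μ := by
  set S := √(∑ i, ‖a i‖ ^ 2) with hS
  have hSsq : S ^ 2 = ∑ i, ‖a i‖ ^ 2 := Real.sq_sqrt (by positivity)
  have hL0 : 0 ≤ ∫ x, ‖∑ i, a i * φ i x‖ ∂μ := integral_nonneg fun x => norm_nonneg _
  rcases (Real.sqrt_nonneg _ : 0 ≤ S).eq_or_lt with h0 | hpos
  · rw [hS, ← h0]
    positivity
  have hfm : AEStronglyMeasurable (fun x => ∑ i, a i * φ i x) μ :=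
    Finset.aestronglyMeasurable_fun_sum _ fun i _ => (hm i).const_mul _
  have hfb : ∀ x, ‖∑ i, a i * φ i x‖ ≤ ∑ i, ‖a i‖ := fun x =>
    norm_sum_le_of_le _ fun i _ => by rw [norm_mul, h1, mul_one]
  have hint : ∀ n : ℕ, Integrable (fun x => ‖∑ i, a i * φ i x‖ ^ n) μ := fun n =>
    Integrable.of_bound (hfm.norm.pow n) ((∑ i, ‖a i‖) ^ n)
      (Filter.Eventually.of_forall fun x => by
        rw [norm_pow, norm_norm]
        exact pow_le_pow_left₀ (norm_nonneg _) (hfb x) n)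
  -- With `t` the modulus of the sum, the difference of the two sides is `4/27 * t * (t - 3/2 S)^2 *
  -- (t + 3 S)`. The constant `4/27` is what makes `t = 3/2 S` a double root.
  have hpt : ∀ x, S ^ 2 * ‖∑ i, a i * φ i x‖ ^ 2 - 4 / 27 * ‖∑ i, a i * φ i x‖ ^ 4 ≤
      S ^ 3 * ‖∑ i, a i * φ i x‖ := by
    intro x
    have ht := norm_nonneg (∑ i, a i * φ i x)
    generalize ‖∑ i, a i * φ i x‖ = t at ht
    have : 0 ≤ t * ((t - 3 / 2 * S) ^ 2 * (t + 3 * S)) := by positivity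
    nlinarith
  have hmono := integral_mono (((hint 2).const_mul (S ^ 2)).sub ((hint 4).const_mul (4 / 27)))
    ((by simpa using hint 1 : Integrable (fun x => ‖∑ i, a i * φ i x‖) μ).const_mul (S ^ 3)) hpt
  simp only [Pi.sub_apply] at hmono
  rw [integral_sub ((hint 2).const_mul _) ((hint 4).const_mul _)] at hmono
  simp only [integral_const_mul] at hmono
  rw [integral_norm_sq_sum_of_orthogonal hm h1 h2, ← hSsq] at hmono
  have h4' := integral_norm_pow_four_sum_le hm h1 h4 a
  rw [← hSsq] at h4'
  -- Second moment `S^2` and fourth moment at most `3 S^4` leave `1 - 3 * 4/27 = 5/9`. The resulting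
  -- constant `9/5` is rounded up to 2.
  have h5 : S ^ 3 * (5 / 9 * S) ≤ S ^ 3 * ∫ x, ‖∑ i, a i * φ i x‖ ∂μ := by nlinarith
  have h6 := le_of_mul_le_mul_left h5 (by positivity)
  linarith

end Orthogonal

/-! ### Random signs -/

section Signs

/-- The Khinchin type inequality for averages over a finite set. -/
theorem sqrt_sum_sq_le_average_norm_sum {ι S : Type*} [Fintype ι] [Fintype S] [Nonempty S]
    {φ : ι → S → ℂ} (h1 : ∀ i s, ‖φ i s‖ = 1)
    (h2 : ∀ i j, i ≠ j → ∑ s, φ i s * starRingEnd ℂ (φ j s) = 0)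
    (h4 : ∀ i j k l, ¬ (i = k ∧ j = l) → ¬ (i = l ∧ j = k) → ¬ (i = j ∧ k = l) →
      ∑ s, φ i s * φ j s * starRingEnd ℂ (φ k s * φ l s) = 0) (a : ι → ℂ) :
    √(∑ i, ‖a i‖ ^ 2) ≤ 2 * ((1 / Fintype.card S) * ∑ s, ‖∑ i, a i * φ i s‖) := by
  classical
  -- The average is the integral for the uniform probability measure on the discrete space `S`.
  let _ : MeasurableSpace S := ⊤
  have : MeasurableSingletonClass S := ⟨fun _ => trivial⟩
  have hreal : ∀ s, ((PMF.uniformOfFintype S).toMeasure).real {s} = 1 / Fintype.card S := by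
    intro s
    rw [measureReal_def, PMF.toMeasure_apply_singleton _ _ (measurableSet_singleton s)]
    simp
  have hI : ∀ {E : Type} [NormedAddCommGroup E] [NormedSpace ℝ E] [CompleteSpace E] (f : S → E),
      ∫ s, f s ∂(PMF.uniformOfFintype S).toMeasure = (1 / Fintype.card S : ℝ) • ∑ s, f s := by
    intro E _ _ _ f
    rw [integral_fintype Integrable.of_finite, Finset.smul_sum]
    simp only [hreal]
  have := sqrt_sum_sq_le_integral_norm_sum (μ := (PMF.uniformOfFintype S).toMeasure) (φ := φ)
    (fun i => (measurable_from_top).aestronglyMeasurable) h1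
    (fun i j h => by rw [hI, h2 i j h, smul_zero])
    (fun i j k l ha hb hc => by rw [hI, h4 i j k l ha hb hc, smul_zero]) a
  rwa [hI, smul_eq_mul] at this

/-- A function of random signs that is odd in one of them has mean zero. -/
theorem sum_signs_eq_zero {ι : Type*} [Fintype ι] [DecidableEq ι] (h : (ι → ℤˣ) → ℂ) (r : ι)
    (hr : ∀ ε, h (ε * Pi.mulSingle r (-1)) = -h ε) : ∑ ε, h ε = 0 := by
  have h1 := Equiv.sum_comp (Equiv.mulRight (Pi.mulSingle r (-1) : ι → ℤˣ)) h
  simp only [Equiv.coe_mulRight, hr, Finset.sum_neg_distrib] at h1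
  linear_combination (-1 / 2 : ℂ) * h1

theorem sign_mul_mulSingle {ι : Type*} [DecidableEq ι] (ε : ι → ℤˣ) (r i : ι) :
    (((ε * Pi.mulSingle r (-1) : ι → ℤˣ) i : ℤ) : ℂ) = (if i = r then -1 else 1) * ((ε i : ℤ) : ℂ) := by
  by_cases h : i = r
  · subst h
    simp
  · simp [h]

/-- Khinchin's inequality. -/
theorem sqrt_sum_sq_le_rademacherMean {m : ℕ} (a : Fin m → ℂ) :
    √(∑ i, ‖a i‖ ^ 2) ≤ 2 * rademacherMean a := by
  have hconj : ∀ n : ℤ, starRingEnd ℂ (n : ℂ) = n := fun n => map_intCast _ n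
  have key := sqrt_sum_sq_le_average_norm_sum (ι := Fin m) (S := Fin m → ℤˣ)
    (φ := fun i ε => ((ε i : ℤ) : ℂ)) ?_ ?_ ?_ a
  · rw [rademacherMean]
    simpa [zsmul_eq_mul, mul_comm] using key
  · intro i ε
    rcases Int.units_eq_one_or (ε i) with h | h <;> simp [h]
  · intro i j hij
    refine sum_signs_eq_zero _ i fun ε => ?_
    simp only [sign_mul_mulSingle, map_mul, map_one, hconj, if_true, if_neg hij.symm]
    ring
  · intro i j k l ha hb hc
    -- As the four indices do not cancel in pairs, some `r` occurs among them an odd number of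
    -- times. The product of the four signs is odd in `ε r`.
    have hex : ∃ r, (if i = r then (-1 : ℂ) else 1) * (if j = r then -1 else 1) *
        ((if k = r then -1 else 1) * (if l = r then -1 else 1)) = -1 := by
      by_cases hij : i = j
      · subst hij
        have hkl : k ≠ l := fun h => hc ⟨rfl, h⟩
        refine ⟨k, ?_⟩
        by_cases hik : i = k <;> simp [hik, hkl.symm]
      · by_cases hik : i = k
        · subst hik
          have hjl : j ≠ l := fun h => ha ⟨rfl, h⟩
          refine ⟨j, ?_⟩
          simp [hij, hjl.symm]
        · by_cases hil : i = l
          · subst hil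
            have hjk : j ≠ k := fun h => hb ⟨rfl, h⟩
            refine ⟨j, ?_⟩
            simp [hij, hjk.symm]
          · refine ⟨i, ?_⟩
            simp [Ne.symm hij, Ne.symm hik, Ne.symm hil]
    obtain ⟨r, hr⟩ := hex
    refine sum_signs_eq_zero _ r fun ε => ?_
    simp only [sign_mul_mulSingle, map_mul, hconj, apply_ite (starRingEnd ℂ), map_neg, map_one]
    linear_combination ((ε i : ℤ) : ℂ) * ((ε j : ℤ) : ℂ) * (((ε k : ℤ) : ℂ) * ((ε l : ℤ) : ℂ)) * hr

/-- Absorbing the signs into the coefficients makes each signed sum an instance of the norm formulas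
for arbitrary coefficients. -/
theorem rademacherMean_smul {E : Type*} [NormedAddCommGroup E] [NormedSpace ℂ E] {m : ℕ}
    (a : Fin m → ℂ) (e : Fin m → E) :
    rademacherMean (fun i => a i • e i) =
      (1 / 2 ^ m) * ∑ ε : Fin m → ℤˣ, ‖∑ i, (((ε i : ℤ) : ℂ) * a i) • e i‖ := by
  simp only [rademacherMean, mul_smul, Int.cast_smul_eq_zsmul]

theorem rademacherMean_le {E : Type*} [NormedAddCommGroup E] {m : ℕ} {y : Fin m → E} {B : ℝ}
    (h : ∀ ε : Fin m → ℤˣ, ‖∑ i, ((ε i : ℤˣ) : ℤ) • y i‖ ≤ B) : rademacherMean y ≤ B := by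
  have h1 := Finset.sum_le_sum fun (ε : Fin m → ℤˣ) (_ : ε ∈ Finset.univ) => h ε
  rw [Finset.sum_const, Finset.card_univ, nsmul_eq_mul] at h1
  have h2 : (Fintype.card (Fin m → ℤˣ) : ℝ) = 2 ^ m := by simp
  rw [h2] at h1
  rw [rademacherMean, one_div, inv_mul_le_iff₀ (by positivity)]
  exact h1

theorem norm_sign (u : ℤˣ) : ‖((u : ℤ) : ℂ)‖ = 1 := by
  rcases Int.units_eq_one_or u with h | h <;> simp [h]

end Signs

/-! ### Norms in `L_2(G, L_1(H))` -/

section Norms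

theorem Continuous.integrable_of_compactSpace {K X : Type*} [TopologicalSpace K] [CompactSpace K]
    [MeasurableSpace K] [OpensMeasurableSpace K] [SecondCountableTopology K]
    [NormedAddCommGroup X] {μ : Measure K} [IsFiniteMeasure μ] {f : K → X} (hf : Continuous f) :
    Integrable f μ := by
  obtain ⟨C, hC⟩ := isCompact_univ.exists_bound_of_continuousOn (f := f) hf.continuousOn
  exact Integrable.of_bound hf.aestronglyMeasurable C
    (Filter.Eventually.of_forall fun x => hC x trivial)

/-- Jensen's inequality for the square. In the outer variable it gives the lower bound for the norm
of `L_2(G, L_1(H))`, in the inner variable the upper bound. -/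
theorem sq_integral_le {Ω : Type*} [MeasurableSpace Ω] {μ : Measure Ω} [IsProbabilityMeasure μ]
    {g : Ω → ℝ} (hg : Integrable g μ) (hg2 : Integrable (fun x => g x ^ 2) μ) :
    (∫ x, g x ∂μ) ^ 2 ≤ ∫ x, g x ^ 2 ∂μ :=
  (even_two.convexOn_pow : ConvexOn ℝ Set.univ fun x : ℝ => x ^ 2).map_integral_le
    (continuous_pow 2).continuousOn isClosed_univ (by simp) hg hg2

variable {G H : Type*} [TopologicalSpace G] [CompactSpace G] [SecondCountableTopology G]
  [MeasurableSpace G] [BorelSpace G] [TopologicalSpace H] [CompactSpace H]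
  [SecondCountableTopology H] [MeasurableSpace H] [BorelSpace H]
  {μ : Measure G} {ν : Measure H} [IsProbabilityMeasure μ] [IsProbabilityMeasure ν]

theorem norm_toLp_one {X : Type*} [NormedAddCommGroup X] [NormedSpace ℂ X] (f : C(G, X)) :
    ‖ContinuousMap.toLp 1 μ ℂ f‖ = ∫ x, ‖f x‖ ∂μ := by
  rw [L1.norm_eq_integral_norm]
  refine integral_congr_ae ?_
  filter_upwards [ContinuousMap.coeFn_toLp (p := 1) (𝕜 := ℂ) μ f] with x hx
  rw [hx]

theorem norm_toLp_two {X : Type*} [NormedAddCommGroup X] [NormedSpace ℂ X] (f : C(G, X)) :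
    ‖ContinuousMap.toLp 2 μ ℂ f‖ = √(∫ x, ‖f x‖ ^ 2 ∂μ) := by
  have h := Lp.memLp (ContinuousMap.toLp 2 μ ℂ f)
  rw [Lp.norm_def, h.eLpNorm_eq_integral_rpow_norm (by simp) (by simp),
    ENNReal.toReal_ofReal (by positivity), Real.sqrt_eq_rpow]
  simp only [ENNReal.toReal_ofNat, Real.rpow_ofNat, one_div]
  congr 1
  refine integral_congr_ae ?_
  filter_upwards [ContinuousMap.coeFn_toLp (p := 2) (𝕜 := ℂ) μ f] with x hx
  rw [hx]

variable {ι : Type*} [Fintype ι] (φ : ι → C(G, ℂ)) (ψ : ι → C(H, ℂ)) (a : ι → ℂ)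

omit [CompactSpace G] [SecondCountableTopology G] [MeasurableSpace G] [BorelSpace G] in
theorem norm_sum_toLp_one (z : G) :
    ‖∑ i, a i • φ i z • ContinuousMap.toLp 1 ν ℂ (ψ i)‖ =
      ∫ w, ‖∑ i, a i * (φ i z * ψ i w)‖ ∂ν := by
  have h : ∑ i, a i • φ i z • ContinuousMap.toLp 1 ν ℂ (ψ i) =
      ContinuousMap.toLp 1 ν ℂ (∑ i, a i • φ i z • ψ i) := by
    simp only [map_sum, map_smul]
  rw [h, norm_toLp_one]
  simp

theorem norm_sum_toLp_two :
    ‖∑ i, a i • ContinuousMap.toLp 2 μ ℂ (vectorMul (φ i) (ContinuousMap.toLp 1 ν ℂ (ψ i)))‖ =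
      √(∫ z, (∫ w, ‖∑ i, a i * (φ i z * ψ i w)‖ ∂ν) ^ 2 ∂μ) := by
  have h : ∑ i, a i • ContinuousMap.toLp 2 μ ℂ
        (vectorMul (φ i) (ContinuousMap.toLp 1 ν ℂ (ψ i))) =
      ContinuousMap.toLp 2 μ ℂ
        (∑ i, a i • vectorMul (φ i) (ContinuousMap.toLp 1 ν ℂ (ψ i))) := by
    simp only [map_sum, map_smul]
  rw [h, norm_toLp_two]
  simp only [← norm_sum_toLp_one]
  simp [vectorMul]

omit [CompactSpace G] [SecondCountableTopology G] [MeasurableSpace G] [BorelSpace G] in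
theorem continuous_integral_norm_sum :
    Continuous fun z => ∫ w, ‖∑ i, a i * (φ i z * ψ i w)‖ ∂ν := by
  -- The integral is the norm of an `L_1(H)`-valued function that is visibly continuous in `z`.
  simp only [← norm_sum_toLp_one]
  fun_prop

/-- The norm of `L_2(G, L_1(H))` dominates that of `L_1(G × H)`. -/
theorem integral_norm_sum_le_norm_sum_toLp :
    ∫ x, ‖∑ i, a i * (φ i x.1 * ψ i x.2)‖ ∂(μ.prod ν) ≤
      ‖∑ i, a i • ContinuousMap.toLp 2 μ ℂ
        (vectorMul (φ i) (ContinuousMap.toLp 1 ν ℂ (ψ i)))‖ := by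
  have hc := continuous_integral_norm_sum (ν := ν) φ ψ a
  rw [norm_sum_toLp_two, integral_prod _ (Continuous.integrable_of_compactSpace (by fun_prop))]
  exact Real.le_sqrt_of_sq_le
    (sq_integral_le hc.integrable_of_compactSpace (hc.pow 2).integrable_of_compactSpace)

/-- The norm of `L_2(G × H)` dominates that of `L_2(G, L_1(H))`. -/
theorem norm_sum_toLp_le_sqrt_integral :
    ‖∑ i, a i • ContinuousMap.toLp 2 μ ℂ
        (vectorMul (φ i) (ContinuousMap.toLp 1 ν ℂ (ψ i)))‖ ≤
      √(∫ x, ‖∑ i, a i * (φ i x.1 * ψ i x.2)‖ ^ 2 ∂(μ.prod ν)) := by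
  have hint : Integrable (fun x : G × H => ‖∑ i, a i * (φ i x.1 * ψ i x.2)‖ ^ 2) (μ.prod ν) :=
    Continuous.integrable_of_compactSpace (by fun_prop)
  rw [norm_sum_toLp_two, integral_prod _ hint]
  refine Real.sqrt_le_sqrt (integral_mono
    ((continuous_integral_norm_sum φ ψ a).pow 2).integrable_of_compactSpace
    hint.integral_prod_left fun z => ?_)
  exact sq_integral_le (Continuous.integrable_of_compactSpace (by fun_prop))
    (Continuous.integrable_of_compactSpace (by fun_prop))

/-- For unimodular `φ i` and `ψ i`, random signs make the norm of `∑ aᵢ φᵢ ⊗ ψᵢ` in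
`L_2(G, L_1(H))` at least of the order of the `ℓ_2` norm of the coefficients. -/
theorem sqrt_sum_sq_le_rademacherMean_toLp {m : ℕ} (φ : Fin m → C(G, ℂ)) (ψ : Fin m → C(H, ℂ))
    (hφ : ∀ i z, ‖φ i z‖ = 1) (hψ : ∀ i w, ‖ψ i w‖ = 1) (a : Fin m → ℂ) :
    √(∑ i, ‖a i‖ ^ 2) ≤ 2 * ((1 / 2 ^ m) * ∑ ε : Fin m → ℤˣ,
      ‖∑ i, (((ε i : ℤ) : ℂ) * a i) • ContinuousMap.toLp 2 μ ℂ
        (vectorMul (φ i) (ContinuousMap.toLp 1 ν ℂ (ψ i)))‖) := by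
  have hint : ∀ ε : Fin m → ℤˣ, Integrable
      (fun x : G × H => ‖∑ i, (((ε i : ℤ) : ℂ) * a i) * (φ i x.1 * ψ i x.2)‖) (μ.prod ν) :=
    fun ε => Continuous.integrable_of_compactSpace (by fun_prop)
  -- At a fixed point this is Khinchin's inequality for the coefficients `a i * (φ i * ψ i)`, which
  -- have the same moduli as the `a i`.
  have hpt : ∀ x : G × H, √(∑ i, ‖a i‖ ^ 2) ≤
      2 * ((1 / 2 ^ m) * ∑ ε : Fin m → ℤˣ,
        ‖∑ i, (((ε i : ℤ) : ℂ) * a i) * (φ i x.1 * ψ i x.2)‖) := by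
    intro x
    have h := sqrt_sum_sq_le_rademacherMean fun i => a i • (φ i x.1 * ψ i x.2)
    rw [rademacherMean_smul] at h
    simpa [hφ, hψ] using h
  calc √(∑ i, ‖a i‖ ^ 2) = ∫ _x : G × H, √(∑ i, ‖a i‖ ^ 2) ∂(μ.prod ν) := by simp
    _ ≤ ∫ x, 2 * ((1 / 2 ^ m) * ∑ ε : Fin m → ℤˣ,
        ‖∑ i, (((ε i : ℤ) : ℂ) * a i) * (φ i x.1 * ψ i x.2)‖) ∂(μ.prod ν) :=
      integral_mono (integrable_const _)
        (((integrable_finsetSum _ fun ε _ => hint ε).const_mul _).const_mul _) hpt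
    _ = 2 * ((1 / 2 ^ m) * ∑ ε : Fin m → ℤˣ,
        ∫ x, ‖∑ i, (((ε i : ℤ) : ℂ) * a i) * (φ i x.1 * ψ i x.2)‖ ∂(μ.prod ν)) := by
      rw [integral_const_mul, integral_const_mul, integral_finsetSum _ fun ε _ => hint ε]
    _ ≤ _ := by
      gcongr with ε _
      exact integral_norm_sum_le_norm_sum_toLp φ ψ _

end Norms

/-! ### Monomials on the circle and its powers -/

section Monomials

theorem haarProb_prod (G H : Type*) [Group G] [TopologicalSpace G] [IsTopologicalGroup G]
    [CompactSpace G] [MeasurableSpace G] [BorelSpace G] [Group H] [TopologicalSpace H]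
    [IsTopologicalGroup H] [CompactSpace H] [MeasurableSpace H] [BorelSpace H]
    [SecondCountableTopology G] [SecondCountableTopology H] :
    haarProb (G × H) = (haarProb G).prod (haarProb H) :=
  Measure.isHaarMeasure_eq_of_isProbabilityMeasure _ _

theorem circleMonomial_apply (n : ℤ) (z : Circle) : circleMonomial n z = (z : ℂ) ^ n := by
  simp [circleMonomial]

theorem circleMonomial_natCast (n : ℕ) (z : Circle) : circleMonomial n z = (z : ℂ) ^ n := by
  simp [circleMonomial_apply]

theorem norm_circleMonomial (n : ℤ) (z : Circle) : ‖circleMonomial n z‖ = 1 :=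
  Circle.norm_coe _

theorem circleMonomial_add (m n : ℤ) (z : Circle) :
    circleMonomial (m + n) z = circleMonomial m z * circleMonomial n z := by
  simp only [circleMonomial, ContinuousMap.coe_mk, zpow_add, Circle.coe_mul]

theorem conj_circleMonomial (n : ℤ) (z : Circle) :
    starRingEnd ℂ (circleMonomial n z) = circleMonomial (-n) z := by
  simp only [circleMonomial, ContinuousMap.coe_mk, zpow_neg, Circle.coe_inv_eq_conj]

theorem integral_circleMonomial {n : ℤ} (hn : n ≠ 0) :
    ∫ z, circleMonomial n z ∂(haarProb Circle) = 0 := by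
  have h := circleMonomial_orthogonal n 0 (by simpa using hn)
  simpa [circleMonomial] using h

/-- `(z, w₁, w₂) ↦ z^p w₁^q w₂^r`. -/
noncomputable def torusThreeMonomial (p q r : ℤ) (x : Circle × Circle × Circle) : ℂ :=
  circleMonomial p x.1 * (circleMonomial q x.2.1 * circleMonomial r x.2.2)

theorem torusThreeMonomial_mul (p q r p' q' r' : ℤ) (x : Circle × Circle × Circle) :
    torusThreeMonomial p q r x * torusThreeMonomial p' q' r' x =
      torusThreeMonomial (p + p') (q + q') (r + r') x := by
  simp only [torusThreeMonomial, circleMonomial_add]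
  ring

theorem conj_torusThreeMonomial (p q r : ℤ) (x : Circle × Circle × Circle) :
    starRingEnd ℂ (torusThreeMonomial p q r x) = torusThreeMonomial (-p) (-q) (-r) x := by
  simp only [torusThreeMonomial, map_mul, conj_circleMonomial]

theorem norm_torusThreeMonomial (p q r : ℤ) (x : Circle × Circle × Circle) :
    ‖torusThreeMonomial p q r x‖ = 1 := by
  simp [torusThreeMonomial, norm_circleMonomial]

theorem continuous_torusThreeMonomial (p q r : ℤ) : Continuous (torusThreeMonomial p q r) := by
  unfold torusThreeMonomial
  fun_prop

theorem integral_torusThreeMonomial {p q r : ℤ} (h : ¬ (p = 0 ∧ q = 0 ∧ r = 0)) :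
    ∫ x, torusThreeMonomial p q r x ∂((haarProb Circle).prod (haarProb (Circle × Circle))) = 0 := by
  unfold torusThreeMonomial
  rw [integral_prod_mul (fun z => circleMonomial p z)
    (fun w : Circle × Circle => circleMonomial q w.1 * circleMonomial r w.2), haarProb_prod,
    integral_prod_mul (fun z => circleMonomial q z) (fun z => circleMonomial r z)]
  by_cases hp : p = 0
  · by_cases hq : q = 0
    · rw [integral_circleMonomial fun hr => h ⟨hp, hq, hr⟩, mul_zero, mul_zero]
    · rw [integral_circleMonomial hq, zero_mul, mul_zero]
  · rw [integral_circleMonomial hp, zero_mul]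

/-- Parseval's identity for polynomials on the circle. -/
theorem integral_norm_sq_sum_pow {N : ℕ} (b : Fin N → ℂ) :
    ∫ w : Circle, ‖∑ i, b i * (w : ℂ) ^ (i : ℕ)‖ ^ 2 ∂(haarProb Circle) = ∑ i, ‖b i‖ ^ 2 := by
  have h := integral_norm_sq_sum_of_orthogonal (μ := haarProb Circle)
    (φ := fun (i : Fin N) z => circleMonomial (i : ℕ) z)
    (fun i => (circleMonomial _).continuous.aestronglyMeasurable)
    (fun i z => norm_circleMonomial _ _) ?_ b
  · simpa only [circleMonomial_natCast] using h
  · intro i j hij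
    simp only [conj_circleMonomial, ← circleMonomial_add]
    refine integral_circleMonomial fun h => hij (Fin.ext ?_)
    omega

/-- The `L_1` norm of polynomials on the circle does not dominate the `ℓ_2` norm of their
coefficients. -/
theorem not_exists_sqrt_sum_sq_le_integral_norm_sum_pow :
    ¬ ∃ C : ℝ, ∀ (N : ℕ) (b : Fin N → ℂ), √(∑ i, ‖b i‖ ^ 2) ≤
      C * ∫ w : Circle, ‖∑ i, b i * (w : ℂ) ^ (i : ℕ)‖ ∂(haarProb Circle) := by
  rintro ⟨C, hC⟩
  -- The test polynomial is `q = (1 + X + ⋯ + X^n)^2`. Its `L_1` norm is `n + 1` by Parseval. Its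
  -- coefficients sum to `(n + 1)^2` and at most `2 (n + 1)` of them are nonzero, so by
  -- Cauchy–Schwarz their squares sum to at least `(n + 1)^3 / 2`. The assumed bound then gives `n +
  -- 1 ≤ 2 C^2`.
  obtain ⟨n, hn⟩ := exists_nat_gt (2 * C ^ 2)
  set q : Polynomial ℂ := (∑ i ∈ Finset.range (n + 1), Polynomial.X ^ i) ^ 2 with hq
  have hdeg : q.natDegree < 2 * (n + 1) := by
    have h1 : (∑ i ∈ Finset.range (n + 1), (Polynomial.X : Polynomial ℂ) ^ i).natDegree ≤ n :=
      Polynomial.natDegree_sum_le_of_forall_le _ _ fun i hi => by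
        rw [Polynomial.natDegree_X_pow]
        exact Nat.lt_succ_iff.1 (Finset.mem_range.1 hi)
    have h2 : q.natDegree ≤ 2 * n := Polynomial.natDegree_pow_le_of_le 2 h1
    omega
  have heval : ∀ x : ℂ, ∑ i : Fin (2 * (n + 1)), q.coeff i * x ^ (i : ℕ) =
      (∑ i : Fin (n + 1), (1 : ℂ) * x ^ (i : ℕ)) ^ 2 := by
    intro x
    rw [Fin.sum_univ_eq_sum_range fun i => q.coeff i * x ^ i,
      ← Polynomial.eval_eq_sum_range' hdeg, hq, Polynomial.eval_pow, Polynomial.eval_finsetSum,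
      Fin.sum_univ_eq_sum_range fun i => 1 * x ^ i]
    simp
  have hL1 : ∫ w : Circle, ‖∑ i : Fin (2 * (n + 1)), q.coeff i * (w : ℂ) ^ (i : ℕ)‖
      ∂(haarProb Circle) = n + 1 := by
    simp only [heval, norm_pow]
    rw [integral_norm_sq_sum_pow]
    simp
  have hle := hC _ fun i : Fin (2 * (n + 1)) => q.coeff i
  rw [hL1] at hle
  have hsq : ∑ i : Fin (2 * (n + 1)), ‖q.coeff i‖ ^ 2 ≤ (C * (n + 1)) ^ 2 := by
    rw [← Real.sq_sqrt (by positivity : 0 ≤ ∑ i : Fin (2 * (n + 1)), ‖q.coeff i‖ ^ 2)]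
    exact pow_le_pow_left₀ (Real.sqrt_nonneg _) hle 2
  have hsum : ((n : ℝ) + 1) ^ 2 ≤ ∑ i : Fin (2 * (n + 1)), ‖q.coeff i‖ := by
    have h1 := heval 1
    simp only [one_pow, mul_one, Finset.sum_const, Finset.card_univ, Fintype.card_fin,
      nsmul_eq_mul] at h1
    have h2 := norm_sum_le Finset.univ fun i : Fin (2 * (n + 1)) => q.coeff i
    rw [h1, norm_pow, Complex.norm_natCast] at h2
    exact_mod_cast h2
  have hcs := sq_sum_le_card_mul_sum_sq (s := Finset.univ)
    (f := fun i : Fin (2 * (n + 1)) => ‖q.coeff i‖)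
  rw [Finset.card_univ, Fintype.card_fin] at hcs
  push_cast at hcs
  have hpos : (0 : ℝ) < n + 1 := by positivity
  have h3 : (((n : ℝ) + 1) ^ 2) ^ 2 ≤ 2 * (n + 1) * (C * (n + 1)) ^ 2 :=
    (pow_le_pow_left₀ (by positivity) hsum 2).trans
      (hcs.trans (mul_le_mul_of_nonneg_left hsq (by positivity)))
  have h4 : ((n : ℝ) + 1) ^ 3 * (n + 1) ≤ (n + 1) ^ 3 * (2 * C ^ 2) := by linarith
  have h5 := le_of_mul_le_mul_left h4 (by positivity)
  linarith

end Monomials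

/-! ### The frequencies of the example -/

section Frequencies

/-- Uniqueness of binary expansions. With the exponents ordered, parity and size decide whether the
smallest one is zero; otherwise both sides are halved. -/
theorem two_pow_add_two_pow_eq {a b c d : ℕ} (h : 2 ^ a + 2 ^ b = 2 ^ c + 2 ^ d) :
    (a = c ∧ b = d) ∨ (a = d ∧ b = c) := by
  have key : ∀ {a b c d : ℕ}, a ≤ b → c ≤ d → 2 ^ a + 2 ^ b = 2 ^ c + 2 ^ d → a = c ∧ b = d := by
    intro a
    induction a with
    | zero =>
      intro b c d _ hcd h
      rcases c with _ | c
      · exact ⟨rfl, Nat.pow_right_injective le_rfl (by simpa using h)⟩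
      · rcases d with _ | d
        · omega
        · rcases b with _ | b
          · have h1 := Nat.one_le_two_pow (n := c)
            have h2 := Nat.one_le_two_pow (n := d)
            rw [pow_succ, pow_succ] at h
            omega
          · rw [pow_succ, pow_succ, pow_succ] at h
            omega
    | succ a ih =>
      intro b c d hab hcd h
      rcases b with _ | b
      · omega
      rcases c with _ | c
      · rcases d with _ | d
        · have h1 := Nat.one_le_two_pow (n := a)
          have h2 := Nat.one_le_two_pow (n := b)
          rw [pow_succ, pow_succ] at h
          omega
        · rw [pow_succ, pow_succ, pow_succ] at h
          omega
      · rcases d with _ | d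
        · omega
        · have := ih (b := b) (c := c) (d := d) (by omega) (by omega) (by
            rw [pow_succ, pow_succ, pow_succ, pow_succ] at h
            omega)
          omega
  rcases le_total a b with hab | hab <;> rcases le_total c d with hcd | hcd
  · exact Or.inl (key hab hcd h)
  · exact Or.inr (key hab hcd (by omega))
  · have := key hab hcd (by omega)
    omega
  · have := key hab hcd (by omega)
    omega

open Classical in
/-- The exponent of `w₁` in `powerRUCSeq n`. -/
noncomputable def firstExponent (n : ℕ) : ℕ := if ∃ k : ℕ, n = 2 ^ k then Nat.log 2 n else 0

open Classical in
/-- The exponent of `w₂` in `powerRUCSeq n`. -/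
noncomputable def secondExponent (n : ℕ) : ℕ := if ∃ k : ℕ, n = 2 ^ k then 0 else 2 ^ n

theorem firstExponent_two_pow (k : ℕ) : firstExponent (2 ^ k) = k := by
  rw [firstExponent, if_pos ⟨k, rfl⟩, Nat.log_pow one_lt_two]

theorem secondExponent_two_pow (k : ℕ) : secondExponent (2 ^ k) = 0 := by
  rw [secondExponent, if_pos ⟨k, rfl⟩]

theorem firstExponent_of_ne {n : ℕ} (h : ¬ ∃ k : ℕ, n = 2 ^ k) : firstExponent n = 0 := by
  rw [firstExponent, if_neg h]

theorem secondExponent_of_ne {n : ℕ} (h : ¬ ∃ k : ℕ, n = 2 ^ k) : secondExponent n = 2 ^ n := by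
  rw [secondExponent, if_neg h]

/-- A single formula for both kinds of `n` turns every `x_n z^n` into a character of `𝕋³`. -/
theorem powerRUCSeq_eq (n : ℕ+) :
    powerRUCSeq n = torusTwoMonomial (firstExponent n) (secondExponent n) := by
  by_cases h : ∃ k : ℕ, (n : ℕ) = 2 ^ k
  · obtain ⟨k, hk⟩ := h
    rw [powerRUCSeq_of_eq hk, hk, firstExponent_two_pow, secondExponent_two_pow]
  · rw [powerRUCSeq_of_ne (by simpa using h), firstExponent_of_ne h, secondExponent_of_ne h]

/-- The triples `(n, firstExponent n, secondExponent n)` form a Sidon set. -/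
theorem frequencies_sidon {a b c d : ℕ} (h0 : a + b = c + d)
    (h1 : firstExponent a + firstExponent b = firstExponent c + firstExponent d)
    (h2 : secondExponent a + secondExponent b = secondExponent c + secondExponent d) :
    (a = c ∧ b = d) ∨ (a = d ∧ b = c) := by
  -- The one delicate case has a single power of two, `a`, among the four. The exponents of `w₂`
  -- force `c = d = b - 1`, and the exponent of `w₁` forces `a = 2^0 = 1`. Then `1 + b = 2 (b - 1)`,
  -- so `c = 2` would be a power of two. The exponent of `w₁` is needed here: `4 + 6 = 5 + 5` and
  -- `2^6 = 2^5 + 2^5`.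
  have mixed : ∀ {k a b c d : ℕ}, a = 2 ^ k → k = 0 → ¬ (∃ k : ℕ, c = 2 ^ k) → a + b = c + d →
      2 ^ b = 2 ^ c + 2 ^ d → False := by
    rintro k a b c d rfl rfl hc h0 h2
    rcases b with _ | b
    · have h3 := Nat.one_le_two_pow (n := c)
      have h4 := Nat.one_le_two_pow (n := d)
      omega
    · have := two_pow_add_two_pow_eq (show 2 ^ b + 2 ^ b = 2 ^ c + 2 ^ d by omega)
      exact hc ⟨1, by omega⟩
  have inj : ∀ {m n : ℕ}, 2 ^ m = 2 ^ n → m = n := fun h => Nat.pow_right_injective le_rfl h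
  have hcase : ∀ n : ℕ, (∃ k, n = 2 ^ k ∧ firstExponent n = k ∧ secondExponent n = 0) ∨
      ((¬ ∃ k : ℕ, n = 2 ^ k) ∧ firstExponent n = 0 ∧ secondExponent n = 2 ^ n ∧ 0 < 2 ^ n) := by
    intro n
    by_cases h : ∃ k : ℕ, n = 2 ^ k
    · obtain ⟨k, rfl⟩ := h
      exact Or.inl ⟨k, rfl, firstExponent_two_pow k, secondExponent_two_pow k⟩
    · exact Or.inr ⟨h, firstExponent_of_ne h, secondExponent_of_ne h, Nat.two_pow_pos n⟩
  rcases hcase a with ⟨i, hi, ha1, ha2⟩ | ⟨ha, ha1, ha2, pa⟩ <;>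
  rcases hcase b with ⟨j, hj, hb1, hb2⟩ | ⟨hb, hb1, hb2, pb⟩ <;>
  rcases hcase c with ⟨k, hk, hc1, hc2⟩ | ⟨hc, hc1, hc2, pc⟩ <;>
  rcases hcase d with ⟨l, hl, hd1, hd2⟩ | ⟨hd, hd1, hd2, pd⟩ <;>
  rw [ha1, hb1, hc1, hd1] at h1 <;>
  rw [ha2, hb2, hc2, hd2] at h2
  · rw [hi, hj, hk, hl] at h0 ⊢
    rcases two_pow_add_two_pow_eq h0 with ⟨rfl, rfl⟩ | ⟨rfl, rfl⟩ <;> simp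
  · omega
  · omega
  · omega
  · omega
  · have := inj (show 2 ^ b = 2 ^ d by omega)
    omega
  · have := inj (show 2 ^ b = 2 ^ c by omega)
    omega
  · exact (mixed hi (by omega) hc h0 (by omega)).elim
  · omega
  · have := inj (show 2 ^ a = 2 ^ d by omega)
    omega
  · have := inj (show 2 ^ a = 2 ^ c by omega)
    omega
  · exact (mixed hj (by omega) hc (by omega : b + a = c + d) (by omega)).elim
  · omega
  · exact (mixed hk (by omega) ha (by omega : c + d = a + b) (by omega)).elim
  · exact (mixed hl (by omega) ha (by omega : d + c = a + b) (by omega)).elim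
  · exact two_pow_add_two_pow_eq h2

end Frequencies

/-! ### The example -/

section Example

/-- The function `(w₁, w₂) ↦ w₁^j w₂^l`. -/
noncomputable def torusTwoFunction (j l : ℕ) : C(Circle × Circle, ℂ) :=
  ⟨fun w => (w.1 : ℂ) ^ j * (w.2 : ℂ) ^ l, by fun_prop⟩

theorem torusTwoMonomial_eq (j l : ℕ) :
    torusTwoMonomial j l =
      ContinuousMap.toLp 1 (haarProb (Circle × Circle)) ℂ (torusTwoFunction j l) := rfl

theorem norm_torusTwoFunction (j l : ℕ) (w : Circle × Circle) : ‖torusTwoFunction j l w‖ = 1 := by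
  simp [torusTwoFunction, Circle.norm_coe]

theorem norm_torusMonomial (α : ℕ →₀ ℤ) (z : ℕ → Circle) : ‖torusMonomial α z‖ = 1 :=
  Circle.norm_coe _

/-- The prime 2 has index 0. The lacunary frequencies `2^k` of the power series become the
consecutive powers of one variable. -/
theorem bohrIndex_of_eq_two_pow {n : ℕ+} {k : ℕ} (h : (n : ℕ) = 2 ^ k) :
    bohrIndex n = Finsupp.single 0 (k : ℤ) := by
  ext j
  rw [bohrIndex_apply, h, Nat.prime_two.factorization_pow, Finsupp.single_apply,
    Finsupp.single_apply, ← Nat.nth_prime_zero_eq_two]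
  simp only [(Nat.nth_injective Nat.infinite_setOfPred_prime).eq_iff]
  split_ifs <;> rfl

/-- The sequence `xₙ zⁿ` is RUC. -/
theorem isRUC_powerTerm : IsRUC (fun n : ℕ+ => powerTerm 2 (powerRUCSeq n) (n : ℕ)) := by
  refine ⟨2, fun m a => ?_⟩
  let n : Fin m → ℕ := fun i => i + 1
  have hn : ∀ {i j : Fin m}, n i = n j → i = j := fun h => Fin.ext (Nat.succ_injective h)
  let φ : Fin m → C(Circle, ℂ) := fun i => circleMonomial (n i)
  let ψ : Fin m → C(Circle × Circle, ℂ) := fun i =>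
    torusTwoFunction (firstExponent (n i)) (secondExponent (n i))
  let Φ : Fin m → Circle × Circle × Circle → ℂ := fun i =>
    torusThreeMonomial (n i) (firstExponent (n i)) (secondExponent (n i))
  have hΦ : ∀ i x, φ i x.1 * ψ i x.2 = Φ i x := by
    intro i x
    simp only [φ, ψ, Φ, torusTwoFunction, torusThreeMonomial, circleMonomial_natCast,
      ContinuousMap.coe_mk]
  have hm : ∀ i, AEStronglyMeasurable (Φ i)
      ((haarProb Circle).prod (haarProb (Circle × Circle))) := fun i =>
    (continuous_torusThreeMonomial _ _ _).aestronglyMeasurable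
  have h1 : ∀ i x, ‖Φ i x‖ = 1 := fun i x => norm_torusThreeMonomial _ _ _ _
  have h2 : ∀ i j, i ≠ j → ∫ x, Φ i x * starRingEnd ℂ (Φ j x)
      ∂((haarProb Circle).prod (haarProb (Circle × Circle))) = 0 := by
    intro i j hij
    simp only [Φ, conj_torusThreeMonomial, torusThreeMonomial_mul]
    exact integral_torusThreeMonomial fun h => hij (hn (by omega))
  have h4 : ∀ i j k l, ¬ (i = k ∧ j = l) → ¬ (i = l ∧ j = k) → ¬ (i = j ∧ k = l) →
      ∫ x, Φ i x * Φ j x * starRingEnd ℂ (Φ k x * Φ l x)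
        ∂((haarProb Circle).prod (haarProb (Circle × Circle))) = 0 := by
    intro i j k l hik hil _
    simp only [Φ, torusThreeMonomial_mul, conj_torusThreeMonomial]
    refine integral_torusThreeMonomial fun h => ?_
    rcases frequencies_sidon (a := n i) (b := n j) (c := n k) (d := n l)
      (by omega) (by omega) (by omega) with h | h
    · exact hik ⟨hn h.1, hn h.2⟩
    · exact hil ⟨hn h.1, hn h.2⟩
  have hnorm : ∀ c : Fin m → ℂ,
      ‖∑ i, c i • powerTerm 2 (powerRUCSeq (Nat.succPNat i)) (Nat.succPNat i : ℕ)‖ =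
      ‖∑ i, c i • ContinuousMap.toLp 2 (haarProb Circle) ℂ
        (vectorMul (φ i) (ContinuousMap.toLp 1 (haarProb (Circle × Circle)) ℂ (ψ i)))‖ := by
    intro c
    rw [Submodule.coe_norm, Submodule.coe_sum]
    simp only [Submodule.coe_smul, powerTerm, powerRUCSeq_eq, torusTwoMonomial_eq]
    rfl
  have hlower := (sqrt_sum_sq_le_integral_norm_sum hm h1 h2 h4 a)
  have hL1 := integral_norm_sum_le_norm_sum_toLp (μ := haarProb Circle)
    (ν := haarProb (Circle × Circle)) φ ψ a
  simp only [hΦ] at hL1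
  rw [hnorm]
  -- The `ℓ_2` norm of `a` separates the two sides: it is at most twice the norm of the unsigned
  -- sum, and at least the norm of each signed sum.
  refine le_trans ?_ (hlower.trans (mul_le_mul_of_nonneg_left hL1 zero_le_two))
  refine rademacherMean_le fun ε => ?_
  have hupper := norm_sum_toLp_le_sqrt_integral (μ := haarProb Circle)
    (ν := haarProb (Circle × Circle)) φ ψ fun i => ((ε i : ℤ) : ℂ) * a i
  simp only [hΦ] at hupper
  rw [integral_norm_sq_sum_of_orthogonal hm h1 h2] at hupper
  simp only [norm_mul, norm_sign, one_mul] at hupper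
  refine le_trans (le_of_eq ?_) hupper
  rw [← hnorm]
  simp only [mul_smul, Int.cast_smul_eq_zsmul]

/-- The integral of a function of `z₀ w₁` over the second pair of variables. -/
theorem integral_mul_fst (g : Circle → ℝ) (u : Circle) :
    ∫ w : Circle × Circle, g (u * w.1) ∂(haarProb (Circle × Circle)) =
      ∫ z, g z ∂(haarProb Circle) := by
  rw [haarProb_prod, integral_fun_fst (fun z => g (u * z)), probReal_univ, one_smul,
    integral_mul_left_eq_self]

/-- Bohr's transform is an isometry, so the norm can be computed in `L_2(𝕋^ℕ, L_1(𝕋²))`. -/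
theorem norm_sum_dirichletTerm {m : ℕ} (c : Fin m → ℂ) :
    ‖∑ i, c i • dirichletTerm 2 (powerRUCSeq (Nat.succPNat i)) (Nat.succPNat i)‖ =
      ‖∑ i, c i • ContinuousMap.toLp 2 (haarProb (ℕ → Circle)) ℂ
        (vectorMul (torusMonomial (bohrIndex (Nat.succPNat i)))
          (ContinuousMap.toLp 1 (haarProb (Circle × Circle)) ℂ
            (torusTwoFunction (firstExponent (i + 1)) (secondExponent (i + 1)))))‖ := by
  simp only [← bohrEquiv_torusTerm, ← map_smul (bohrEquiv 2 LOneTorus)]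
  rw [← map_sum, norm_bohrEquiv, Submodule.coe_norm, Submodule.coe_sum]
  simp only [Submodule.coe_smul, torusTerm, powerRUCSeq_eq, torusTwoMonomial_eq]
  rfl

/-- The sequence `xₙ n^{-s}` is not RUC. -/
theorem not_isRUC_dirichletTerm : ¬ IsRUC (fun n : ℕ+ => dirichletTerm 2 (powerRUCSeq n) n) := by
  rintro ⟨C, hC⟩
  refine not_exists_sqrt_sum_sq_le_integral_norm_sum_pow ⟨2 * C, fun N b => ?_⟩
  -- The index `i` stands for the integer `i + 1`, so `2^k` sits at position `2^k - 1`. The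
  -- coefficients `b` are placed there and all others are zero.
  let e : Fin N → Fin (2 ^ N) := fun k => ⟨2 ^ (k : ℕ) - 1, by
    have := Nat.pow_lt_pow_right (a := 2) (by norm_num) k.2
    have := Nat.two_pow_pos k
    omega⟩
  have he1 : ∀ k, ((e k : Fin (2 ^ N)) : ℕ) + 1 = 2 ^ (k : ℕ) := fun k =>
    Nat.sub_add_cancel Nat.one_le_two_pow
  have he : Function.Injective e := fun k l h => Fin.ext (Nat.pow_right_injective le_rfl (by
    change 2 ^ (k : ℕ) = 2 ^ (l : ℕ)
    rw [← he1, ← he1, h]))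
  let a : Fin (2 ^ N) → ℂ := Function.extend e b fun _ => 0
  have ha : ∀ k, a (e k) = b k := fun k => he.extend_apply b _ k
  have ha0 : ∀ i ∉ Set.range e, a i = 0 := fun i hi => Function.extend_apply' b _ i hi
  have hsq : ∑ k, ‖b k‖ ^ 2 = ∑ i, ‖a i‖ ^ 2 :=
    Fintype.sum_of_injective e he _ _ (fun i hi => by simp [ha0 i hi]) fun k => by rw [ha]
  have hF : ∀ (z : ℕ → Circle) (w : Circle × Circle),
      ∑ i, a i * (torusMonomial (bohrIndex (Nat.succPNat i)) z *
        torusTwoFunction (firstExponent (i + 1)) (secondExponent (i + 1)) w) =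
      ∑ k, b k * ((z 0 * w.1 : Circle) : ℂ) ^ (k : ℕ) := by
    intro z w
    symm
    refine Fintype.sum_of_injective e he _ _ (fun i hi => by simp [ha0 i hi]) fun k => ?_
    have h2k : ((Nat.succPNat (e k) : ℕ+) : ℕ) = 2 ^ (k : ℕ) := he1 k
    rw [ha, he1, firstExponent_two_pow, secondExponent_two_pow, bohrIndex_of_eq_two_pow h2k]
    simp [torusMonomial, torusCharacter_single, torusTwoFunction, mul_pow]
  have hnorm : ‖∑ i, a i • dirichletTerm 2 (powerRUCSeq (Nat.succPNat i)) (Nat.succPNat i)‖ =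
      ∫ w : Circle, ‖∑ k, b k * (w : ℂ) ^ (k : ℕ)‖ ∂(haarProb Circle) := by
    rw [norm_sum_dirichletTerm, norm_sum_toLp_two]
    simp only [hF]
    -- Rotating `w₁` by `z 0` removes `z`: the inner `L_1` norm is constant and the outer `L_2` norm
    -- returns it.
    simp only [integral_mul_fst (fun u : Circle => ‖∑ k, b k * (u : ℂ) ^ (k : ℕ)‖)]
    rw [integral_const, probReal_univ, one_smul,
      Real.sqrt_sq (integral_nonneg fun w => norm_nonneg _)]
  have h1 := hC (2 ^ N) a
  rw [rademacherMean_smul, hnorm] at h1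
  simp only [norm_sum_dirichletTerm] at h1
  have h2 := sqrt_sum_sq_le_rademacherMean_toLp (μ := haarProb (ℕ → Circle))
    (ν := haarProb (Circle × Circle))
    (fun i : Fin (2 ^ N) => torusMonomial (bohrIndex (Nat.succPNat i)))
    (fun i : Fin (2 ^ N) => torusTwoFunction (firstExponent (i + 1)) (secondExponent (i + 1)))
    (fun i z => norm_torusMonomial _ _) (fun i w => norm_torusTwoFunction _ _ _) a
  rw [hsq, mul_assoc]
  exact h2.trans (mul_le_mul_of_nonneg_left h1 zero_le_two)

/-- The extra factor `w` is unimodular, so polynomials starting at degree 1 and at degree 0 have the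
same norms. -/
theorem norm_sum_mul_pow_succ {N : ℕ} (a : Fin N → ℂ) (w : Circle) :
    ‖∑ i, a i * (w : ℂ) ^ ((i : ℕ) + 1)‖ = ‖∑ i, a i * (w : ℂ) ^ (i : ℕ)‖ := by
  simp only [pow_succ, ← mul_assoc, ← Finset.sum_mul, norm_mul, Circle.norm_coe, mul_one]

end Example

theorem mainTheorem6 :
    IsRUC (fun n : ℕ+ => powerTerm 2 (powerRUCSeq n) (n : ℕ)) ∧
    ¬ IsRUC (fun n : ℕ+ => dirichletTerm 2 (powerRUCSeq n) n) ∧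
    ¬ ∃ C : ℝ, ∀ (N : ℕ) (a : Fin N → ℂ),
      (∫ w : Circle, ‖∑ i, a i * (w : ℂ) ^ ((i : ℕ) + 1)‖ ^ 2 ∂(haarProb Circle)) ^ (1 / 2 : ℝ) ≤
        C * ∫ w : Circle, ‖∑ i, a i * (w : ℂ) ^ ((i : ℕ) + 1)‖ ∂(haarProb Circle) := by
  refine ⟨isRUC_powerTerm, not_isRUC_dirichletTerm, ?_⟩
  rintro ⟨C, hC⟩
  refine not_exists_sqrt_sum_sq_le_integral_norm_sum_pow ⟨C, fun N b => ?_⟩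
  have h := hC N b
  simp only [norm_sum_mul_pow_succ] at h
  rwa [integral_norm_sq_sum_pow, ← Real.sqrt_eq_rpow] at h
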